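/- For every constant $c\in\mathbb N$ there is a constant $C>0$ such that the following holds. Let $G=(V,E,w)$ be a complete undirected graph on a finite vertex set $V$ with $n=|V|\ge 2$ vertices and integer edge weights $w:E\to\{1,2,\dots,L\}$, where $L\le n^{c}$; let $h\ge 1$ and $0<\varepsilon<\tfrac13$. For $t\ge 1$ let $d_G^{(t)}(u,v)$ denote the minimum weight of a (not necessarily simple) path between $u$ and $v$ in $G$ with at most $t$ edges. Then there is a probability distribution $\mathcal D$ over metrics $d$, each defined on some subset $V_d\subseteq V$, with the following properties. 1. (Well-separated tree metrics.) Every $d$ in the support of $\mathcal D$ is the shortest-path metric of a weighted rooted tree $T$ with vertex set exactly $V_d$, whose edge weights are powers of $2$ that strictly decrease along every root-to-leaf path. 2. (Exclusion probability at most $\varepsilon$.) $\Pr_{d\sim\mathcal D}[v\in V_d]\ge 1-\varepsilon$ for every $v\in V$. 3. (Expected distance stretch.) There is $\alpha_{\mathbb E}\le C\log n\cdot\log\frac{\log n}{\varepsilon}$ such that for all $u,v\in V$, $$\mathbb E_{d\sim\mathcal D}\bigl[d(u,v)\cdot \mathbf 1\{u,v\in V_d\}\bigr]\le \alpha_{\mathbb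 E}\cdot d_G^{(h)}(u,v).$$ 4. (Worst-case distance stretch and hop stretch.) There are $\alpha_{\mathrm{WC}},\beta\ge 1$ with $\alpha_{\mathrm{WC}}\le C\frac{\log^2 n}{\varepsilon}$ and $\beta\le C\frac{\log^2 n}{\varepsilon}$ such that for every $d$ in the support of $\mathcal D$ and all $u,v\in V_d$, $$d_G^{(\beta h)}(u,v)\le d(u,v)\le \alpha_{\mathrm{WC}}\cdot d_G^{(h)}(u,v).$$ -/

import Mathlib

namespace HopConstrained

/-- The weight `w(P)` of a (not necessarily simple) path `P`: the sum of the weights of the edges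
in its edge set. -/
noncomputable def pathWeight {V : Type*} {G : SimpleGraph V} (w : Sym2 V → ℝ) {u v : V}
    (p : G.Walk u v) : ℝ :=
  open Classical in ∑ e ∈ p.edges.toFinset, w e

/-- The hop-constrained distance `d_G^{(h)}(u, v)`: the minimum weight of a path between `u` and `v`
with at most `h` hops (`h` may be any real number). -/
noncomputable def hopDist {V : Type*} (G : SimpleGraph V) (w : Sym2 V → ℝ) (h : ℝ) (u v : V) : ℝ :=
  sInf {x : ℝ | ∃ p : G.Walk u v, (p.length : ℝ) ≤ h ∧ pathWeight w p = x}

/-- The shortest-path distance `d_G(u, v)`: the minimum weight of a path between `u` and `v`. -/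
noncomputable def shortestPathDist {V : Type*} (G : SimpleGraph V) (w : Sym2 V → ℝ) (u v : V) : ℝ :=
  sInf {x : ℝ | ∃ p : G.Walk u v, pathWeight w p = x}

/-- A partial metric on `V`: a metric on a subset of `V`. -/
structure PartialMetric (V : Type*) where
  /-- The set `V_d` on which the metric lives. -/
  carrier : Set V
  /-- The metric on `V_d`. -/
  metric : MetricSpace carrier

/-- The weighted graph `(T, w)` with root `r` is well-separated: every edge weight is a power of
two, and along every simple path that starts at the root the weights are strictly decreasing. -/
def IsWellSeparated {V : Type*} (T : SimpleGraph V) (w : Sym2 V → ℝ) (r : V) : Prop :=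
  (∀ e ∈ T.edgeSet, ∃ k : ℤ, w e = (2 : ℝ) ^ k) ∧
    ∀ (v : V) (p : T.Walk r v), p.IsPath → (p.edges.map w).Pairwise (fun x y => y < x)

/-- The partial metric `d` is the shortest-path metric of a well-separated rooted weighted tree
whose vertex set is exactly the set on which `d` is defined. -/
def PartialMetric.IsWellSeparatedTreeMetric {V : Type*} (d : PartialMetric V) : Prop :=
  ∃ (T : SimpleGraph d.carrier) (w : Sym2 d.carrier → ℝ) (r : d.carrier),
    T.IsTree ∧ IsWellSeparated T w r ∧
      ∀ u v : d.carrier, d.metric.dist u v = shortestPathDist T w u v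

/-- The partial metric `d` approximates the `h`-hop distances of `(G, w)` on the set on which it is
defined, with distance stretch `α` and hop stretch `β`. -/
def PartialMetric.Approximates {V : Type*} (d : PartialMetric V) (G : SimpleGraph V)
    (w : Sym2 V → ℝ) (h α β : ℝ) : Prop :=
  ∀ u v : d.carrier,
    hopDist G w (β * h) u v ≤ d.metric.dist u v ∧ d.metric.dist u v ≤ α * hopDist G w h u v

/-- `d(u, v) · 1{u, v ∈ V_d}`, as an extended nonnegative real. -/
noncomputable def PartialMetric.distOrZero {V : Type*} (d : PartialMetric V) (u v : V) : ENNReal :=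
  open Classical in
  if huv : u ∈ d.carrier ∧ v ∈ d.carrier then
    ENNReal.ofReal (d.metric.dist ⟨u, huv.1⟩ ⟨v, huv.2⟩) else 0

/-- The distribution `D` has exclusion probability at most `ε`: each vertex is contained in the
random partial metric with probability at least `1 - ε`. -/
def ExclusionProbabilityLE {V : Type*} (D : PMF (PartialMetric V)) (ε : ℝ) : Prop :=
  ∀ v : V, ENNReal.ofReal (1 - ε) ≤ D.toOuterMeasure {d | v ∈ d.carrier}

/-- The induced distance `d_D(u, v) = E[d(u, v) · 1{u, v ∈ V_d}]`, a priori possibly infinite. -/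
noncomputable def inducedDist {V : Type*} (D : PMF (PartialMetric V)) (u v : V) : ENNReal :=
  ∑' d, D d * d.distOrZero u v

/-- Worst-case distance stretch `α` and hop stretch `β`: both at least one, and every partial metric
in the support is an approximation with these stretches. -/
def HasWorstCaseStretch {V : Type*} (D : PMF (PartialMetric V)) (G : SimpleGraph V)
    (w : Sym2 V → ℝ) (h α β : ℝ) : Prop :=
  1 ≤ α ∧ 1 ≤ β ∧ ∀ d ∈ D.support, d.Approximates G w h α β

/-- Expected distance stretch `α` with respect to the `h`-hop distances of `(G, w)`. -/
def HasExpectedStretch {V : Type*} (D : PMF (PartialMetric V)) (G : SimpleGraph V)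
    (w : Sym2 V → ℝ) (h α : ℝ) : Prop :=
  ∀ u v : V, inducedDist D u v ≤ ENNReal.ofReal (α * hopDist G w h u v)

end HopConstrained

open HopConstrained

namespace HopConstrained

/-! ### Mixed weight/hop distances on walks -/

section Walks

variable {V : Type*} {G : SimpleGraph V} {w : Sym2 V → ℝ}

/-! At scale `j`, give a walk the cost `weight / 2 ^ j + hops / (β h)`. The infimum `m_j` of this
cost (`mixedDist`) is a true pseudometric, unlike the hop-constrained distance, so ball carving
applies to it. It translates both ways: `m_j(u, v) < 1` yields a walk of weight below `2 ^ j` with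
at most `β h` hops, and `m_j ≤ d / 2 ^ j + 1 / β` for `d = d_G^{(h)}` (`mixedDist_top_le_hopDist`).

Carve each of the `K = O(log n)` scales with one random order and one random radius below `1/2`. A
ball of radius `ρ ≥ 1 / β` is cut at a given scale with probability `O(ρ log n)` (`card_cut_le`).
Exclude the vertices whose `2 / β`-ball is cut at some scale; for `β` of order `K log n / ε` the
union bound gives exclusion probability `ε`. Two distinct surviving vertices separated at scale `j`
have `m_j > 2 / β`, hence `2 ^ j < β d`, which bounds the worst-case stretch.

The last separating scale defines an ultrametric, which becomes a tree on the same vertices at the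
cost of a factor four (`exists_wellSeparatedTreeMetric`, used in `exists_approximating_treeMetric`).
In expectation, scales with `2 ^ j ≤ d` form a geometric sum, and the `O(log β)` scales between `d`
and `β d` contribute `O(log n) d` each (`sum_scales_le`). Only union bounds and linearity of
expectation combine scales, so they may share their randomness. -/

theorem pathWeight_nonneg (hw : ∀ e, 0 ≤ w e) {u v : V} (p : G.Walk u v) : 0 ≤ pathWeight w p := by
  classical
  exact Finset.sum_nonneg fun e _ => hw e

/-- Only an inequality: weights are summed over the edge set, so an edge common to both walks counts
once. -/
theorem pathWeight_append_le (hw : ∀ e, 0 ≤ w e) {u v x : V} (p : G.Walk u v) (q : G.Walk v x) :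
    pathWeight w (p.append q) ≤ pathWeight w p + pathWeight w q := by
  classical
  unfold pathWeight
  rw [SimpleGraph.Walk.edges_append, List.toFinset_append, ← Finset.sum_union_inter]
  have := Finset.sum_nonneg (s := p.edges.toFinset ∩ q.edges.toFinset) fun e _ => hw e
  convert le_add_of_nonneg_right this

theorem pathWeight_reverse {u v : V} (p : G.Walk u v) :
    pathWeight w p.reverse = pathWeight w p := by
  simp [pathWeight, List.toFinset_reverse]

theorem le_pathWeight_of_mem (hw : ∀ e, 0 ≤ w e) {u v : V} (p : G.Walk u v) {e : Sym2 V}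
    (he : e ∈ p.edges) : w e ≤ pathWeight w p := by
  classical
  unfold pathWeight
  convert Finset.single_le_sum (f := w) (fun i _ => hw i) (List.mem_toFinset.2 he)

theorem pathWeight_nil (u : V) : pathWeight w (SimpleGraph.Walk.nil : G.Walk u u) = 0 := by
  simp [pathWeight]

theorem pathWeight_toWalk {u v : V} (h : G.Adj u v) : pathWeight w h.toWalk = w s(u, v) := by
  simp [pathWeight]

/-- The infimum over all walks `p` from `u` to `v` of `a * pathWeight w p + b * p.length`. -/
noncomputable def mixedDist (G : SimpleGraph V) (w : Sym2 V → ℝ) (a b : ℝ) (u v : V) : ℝ :=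
  ⨅ p : G.Walk u v, (a * pathWeight w p + b * p.length)

theorem shortestPathDist_eq_mixedDist (u v : V) :
    shortestPathDist G w u v = mixedDist G w 1 0 u v := by
  simp [shortestPathDist, mixedDist, iInf, Set.range]

variable {a b : ℝ}

theorem mixedCost_nonneg (hw : ∀ e, 0 ≤ w e) (ha : 0 ≤ a) (hb : 0 ≤ b) {u v : V}
    (p : G.Walk u v) : 0 ≤ a * pathWeight w p + b * p.length := by
  have := pathWeight_nonneg hw p
  positivity

theorem bddBelow_mixedCost (hw : ∀ e, 0 ≤ w e) (ha : 0 ≤ a) (hb : 0 ≤ b) (u v : V) :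
    BddBelow (Set.range fun p : G.Walk u v => a * pathWeight w p + b * p.length) :=
  ⟨0, by rintro _ ⟨p, rfl⟩; exact mixedCost_nonneg hw ha hb p⟩

theorem mixedDist_le (hw : ∀ e, 0 ≤ w e) (ha : 0 ≤ a) (hb : 0 ≤ b) {u v : V} (p : G.Walk u v) :
    mixedDist G w a b u v ≤ a * pathWeight w p + b * p.length :=
  ciInf_le (bddBelow_mixedCost hw ha hb u v) p

theorem mixedDist_nonneg (hw : ∀ e, 0 ≤ w e) (ha : 0 ≤ a) (hb : 0 ≤ b) (u v : V) :
    0 ≤ mixedDist G w a b u v :=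
  Real.iInf_nonneg fun p => mixedCost_nonneg hw ha hb p

theorem mixedDist_self (hw : ∀ e, 0 ≤ w e) (ha : 0 ≤ a) (hb : 0 ≤ b) (u : V) :
    mixedDist G w a b u u = 0 := by
  refine le_antisymm ?_ (mixedDist_nonneg hw ha hb u u)
  simpa [pathWeight_nil] using mixedDist_le (G := G) hw ha hb (SimpleGraph.Walk.nil : G.Walk u u)

theorem mixedDist_comm (hG : G.Preconnected) (hw : ∀ e, 0 ≤ w e) (ha : 0 ≤ a) (hb : 0 ≤ b)
    (u v : V) : mixedDist G w a b u v = mixedDist G w a b v u := by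
  have key : ∀ u v, mixedDist G w a b u v ≤ mixedDist G w a b v u := by
    intro u v
    have : Nonempty (G.Walk v u) := hG v u
    refine le_ciInf fun p => ?_
    simpa [pathWeight_reverse] using mixedDist_le hw ha hb p.reverse
  exact le_antisymm (key u v) (key v u)

theorem mixedDist_triangle (hG : G.Preconnected) (hw : ∀ e, 0 ≤ w e) (ha : 0 ≤ a) (hb : 0 ≤ b)
    (u v x : V) : mixedDist G w a b u x ≤ mixedDist G w a b u v + mixedDist G w a b v x := by
  have : Nonempty (G.Walk u v) := hG u v
  have : Nonempty (G.Walk v x) := hG v x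
  refine le_ciInf_add_ciInf fun p q => ?_
  have h1 := mixedDist_le hw ha hb (p.append q)
  have h2 := mul_le_mul_of_nonneg_left (pathWeight_append_le hw p q) ha
  rw [SimpleGraph.Walk.length_append] at h1
  push_cast at h1
  linarith

theorem bddBelow_hopDist (hw : ∀ e, 0 ≤ w e) (h : ℝ) (u v : V) :
    BddBelow {x : ℝ | ∃ p : G.Walk u v, (p.length : ℝ) ≤ h ∧ pathWeight w p = x} :=
  ⟨0, by rintro _ ⟨p, -, rfl⟩; exact pathWeight_nonneg hw p⟩

theorem hopDist_le (hw : ∀ e, 0 ≤ w e) {h : ℝ} {u v : V} (p : G.Walk u v)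
    (hp : (p.length : ℝ) ≤ h) : hopDist G w h u v ≤ pathWeight w p :=
  csInf_le (bddBelow_hopDist hw h u v) ⟨p, hp, rfl⟩

theorem hopDist_nonneg (hw : ∀ e, 0 ≤ w e) (h : ℝ) (u v : V) : 0 ≤ hopDist G w h u v :=
  Real.sInf_nonneg (by rintro _ ⟨p, -, rfl⟩; exact pathWeight_nonneg hw p)

theorem hopDist_self (hw : ∀ e, 0 ≤ w e) {h : ℝ} (hh : 0 ≤ h) (u : V) :
    hopDist G w h u u = 0 := by
  refine le_antisymm ?_ (hopDist_nonneg hw h u u)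
  simpa [pathWeight_nil] using
    hopDist_le (G := G) hw (h := h) (SimpleGraph.Walk.nil : G.Walk u u) (by simpa using hh)

theorem hopDist_top_le (hw : ∀ e, 0 ≤ w e) {h : ℝ} (hh : 1 ≤ h) {u v : V} (huv : u ≠ v) :
    hopDist ⊤ w h u v ≤ w s(u, v) := by
  have hadj : (⊤ : SimpleGraph V).Adj u v := huv
  rw [← pathWeight_toWalk (w := w) hadj]
  exact hopDist_le hw _ (by simpa using hh)

/-- The mixed distance is controlled by the hop-constrained distance. -/
theorem mixedDist_top_le_hopDist (hw : ∀ e, 0 ≤ w e) (ha : 0 < a) (hb : 0 ≤ b) {h : ℝ}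
    (hh : 1 ≤ h) (u v : V) :
    mixedDist ⊤ w a b u v ≤ a * hopDist ⊤ w h u v + b * h := by
  have hne : {x : ℝ | ∃ p : (⊤ : SimpleGraph V).Walk u v,
      (p.length : ℝ) ≤ h ∧ pathWeight w p = x}.Nonempty := by
    by_cases huv : u = v
    · subst huv
      exact ⟨_, SimpleGraph.Walk.nil, by simp; linarith, rfl⟩
    · have hadj : (⊤ : SimpleGraph V).Adj u v := huv
      exact ⟨_, hadj.toWalk, by simpa using hh, rfl⟩
  have : (mixedDist ⊤ w a b u v - b * h) / a ≤ hopDist ⊤ w h u v := by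
    refine le_csInf hne ?_
    rintro _ ⟨p, hp, rfl⟩
    rw [div_le_iff₀ ha]
    have h1 := mixedDist_le hw ha.le hb p
    have h2 := mul_le_mul_of_nonneg_left hp hb
    linarith
  rw [div_le_iff₀ ha] at this
  linarith

theorem exists_walk_of_mixedDist_lt (hG : G.Preconnected) {u v : V} {x : ℝ}
    (h : mixedDist G w a b u v < x) :
    ∃ p : G.Walk u v, a * pathWeight w p + b * p.length < x := by
  have : Nonempty (G.Walk u v) := hG u v
  exact exists_lt_of_ciInf_lt h

end Walks

/-! ### From an ultrametric to a well-separated tree without extra vertices -/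

section UltrametricTree

variable {X : Type*}

/-- The edge weight `2 ^ l a b`. -/
noncomputable def ultraWeight (l : X → X → ℕ) (hsymm : ∀ a b, l a b = l b a) : Sym2 X → ℝ :=
  Sym2.lift ⟨fun a b => (2 : ℝ) ^ l a b, fun a b => by simp only [hsymm a b]⟩

theorem ultraWeight_nonneg {l : X → X → ℕ} (hsymm : ∀ a b, l a b = l b a) (e : Sym2 X) :
    0 ≤ ultraWeight l hsymm e := by
  induction e with
  | _ a b => simp [ultraWeight]

variable [LinearOrder X]

/-- In the tree of the ultrametric `l`, the vertex `q` is the parent of `a`: it is the least vertex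
of the smallest ball around `a` that contains a vertex below `a`. -/
def IsParent (l : X → X → ℕ) (q a : X) : Prop :=
  q < a ∧ (∀ u, u < a → l q a ≤ l u a) ∧ ∀ u, l u a ≤ l q a → q ≤ u

/-- The graph that joins every vertex with its parent. -/
def ultraTree (l : X → X → ℕ) : SimpleGraph X where
  Adj a b := IsParent l a b ∨ IsParent l b a
  symm := ⟨fun _ _ h => h.symm⟩
  loopless := ⟨fun _ h => h.elim (fun h => h.1.false) (fun h => h.1.false)⟩

variable {l : X → X → ℕ}

theorem IsParent.unique {p q a : X} (hp : IsParent l p a) (hq : IsParent l q a) : p = q :=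
  le_antisymm (hp.2.2 q (hq.2.1 p hp.1)) (hq.2.2 p (hp.2.1 q hq.1))

/-- Otherwise `q` would lie in the ball around `b` of radius `l a b`, whose least vertex is `a`,
although `q < a`. -/
theorem IsParent.lt_of_isParent
    (hultra : ∀ a b c, l a c ≤ max (l a b) (l b c)) {q a b : X} (hq : IsParent l q a)
    (ha : IsParent l a b) : l a b < l q a := by
  by_contra! h
  have h1 : l q b ≤ l a b := (hultra q a b).trans (max_le h le_rfl)
  exact absurd (ha.2.2 q h1) (not_le.2 hq.1)

/-- A simple path that avoids the parent of its start can only descend: its first step goes to a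
child, and from there the parent is already used. The second conjunct strengthens the induction. -/
theorem pairwise_ultraWeight (hsymm : ∀ a b, l a b = l b a)
    (hultra : ∀ a b c, l a c ≤ max (l a b) (l b c)) {a v : X} (p : (ultraTree l).Walk a v)
    (hp : p.IsPath) (hpar : ∀ q, IsParent l q a → q ∉ p.support) :
    (p.edges.map (ultraWeight l hsymm)).Pairwise (fun x y => y < x) ∧
      ∀ q, IsParent l q a → ∀ x ∈ p.edges.map (ultraWeight l hsymm),
        x < ultraWeight l hsymm s(q, a) := by
  induction p with
  | nil => simp
  | @cons a b v hab p ih =>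
    rw [SimpleGraph.Walk.cons_isPath_iff] at hp
    have hpab : IsParent l a b := by
      refine Or.elim hab id fun h => absurd ?_ (hpar b h)
      simp [p.start_mem_support]
    obtain ⟨ih1, ih2⟩ := ih hp.1 fun q hq => by
      rw [hq.unique hpab]
      exact hp.2
    simp only [SimpleGraph.Walk.edges_cons, List.map_cons, List.pairwise_cons]
    refine ⟨⟨ih2 a hpab, ih1⟩, fun q hq x hx => ?_⟩
    have hlt : ultraWeight l hsymm s(a, b) < ultraWeight l hsymm s(q, a) := by
      simpa [ultraWeight] using
        pow_lt_pow_right₀ (one_lt_two (α := ℝ)) (hq.lt_of_isParent hultra hpab)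
    rcases List.mem_cons.1 hx with rfl | hx
    · exact hlt
    · exact (ih2 a hpab x hx).trans hlt

theorem ultraTree_isWellSeparated (hsymm : ∀ a b, l a b = l b a)
    (hultra : ∀ a b c, l a c ≤ max (l a b) (l b c)) {r : X} (hr : ∀ x, r ≤ x) :
    IsWellSeparated (ultraTree l) (ultraWeight l hsymm) r := by
  constructor
  · intro e _
    induction e with
    | _ a b => exact ⟨l a b, by simp [ultraWeight]⟩
  · intro v p hp
    exact (pairwise_ultraWeight hsymm hultra p hp
      fun q hq => absurd (hr q) (not_le.2 hq.1)).1

/-- Along any walk in any graph, some edge is at least as long as the ultrametric distance of the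
end points. -/
theorem two_pow_le_pathWeight (hsymm : ∀ a b, l a b = l b a)
    (hultra : ∀ a b c, l a c ≤ max (l a b) (l b c)) {G : SimpleGraph X} {u v : X} (huv : u ≠ v)
    (p : G.Walk u v) : (2 : ℝ) ^ l u v ≤ pathWeight (ultraWeight l hsymm) p := by
  have key : ∀ {u v : X} (p : G.Walk u v), u ≠ v →
      ∃ e ∈ p.edges, (2 : ℝ) ^ l u v ≤ ultraWeight l hsymm e := by
    intro u v p
    induction p with
    | nil => simp
    | @cons a b c hab p ih =>
      intro hac
      by_cases hbc : b = c
      · subst hbc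
        exact ⟨s(a, b), by simp, by simp [ultraWeight]⟩
      · obtain ⟨e, he, hle⟩ := ih hbc
        rcases le_max_iff.1 (hultra a b c) with h | h
        · exact ⟨s(a, b), by simp, by
            simpa [ultraWeight] using pow_le_pow_right₀ (one_le_two (α := ℝ)) h⟩
        · exact ⟨e, by simp [he], (pow_le_pow_right₀ one_le_two h).trans hle⟩
  obtain ⟨e, he, hle⟩ := key p huv
  exact hle.trans (le_pathWeight_of_mem (ultraWeight_nonneg hsymm) p he)

variable [Finite X]

theorem exists_least (s : Set X) (hs : s.Nonempty) : ∃ c ∈ s, ∀ u ∈ s, c ≤ u := by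
  obtain ⟨c, hc⟩ := (s.toFinite).exists_minimal hs
  exact ⟨c, hc.1, fun u hu => (le_total c u).elim id fun h => hc.2 hu h⟩

/-- Every vertex can reach the least vertex of its ball of radius `i` at a small cost. -/
theorem exists_walk_to_least (hsymm : ∀ a b, l a b = l b a)
    (hultra : ∀ a b c, l a c ≤ max (l a b) (l b c)) (hself : ∀ a, l a a = 0) (u : X) (i : ℕ) :
    ∃ (c : X) (p : (ultraTree l).Walk u c), l u c ≤ i ∧ (∀ x, l u x ≤ i → c ≤ x) ∧
      pathWeight (ultraWeight l hsymm) p ≤ 2 * 2 ^ i := by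
  induction i with
  | zero =>
    obtain ⟨c, hc, hmin⟩ := exists_least {x | l u x ≤ 0} ⟨u, by simp [hself]⟩
    simp only [Set.mem_ofPred_eq] at hc hmin
    by_cases huc : c = u
    · subst huc
      exact ⟨c, SimpleGraph.Walk.nil, hc, hmin, by simp [pathWeight_nil]⟩
    · have hpar : IsParent l c u := by
        refine ⟨lt_of_le_of_ne (hmin u (by simp [hself])) huc, fun x _ => ?_, fun x hx => ?_⟩
        · rw [hsymm c u]; omega
        · exact hmin x (by rw [hsymm u x]; rw [hsymm c u] at hx; omega)
      have hadj : (ultraTree l).Adj u c := Or.inr hpar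
      refine ⟨c, hadj.toWalk, hc, hmin, ?_⟩
      rw [pathWeight_toWalk]
      simp [ultraWeight, Nat.le_zero.1 hc]
  | succ i ih =>
    obtain ⟨c, p, hc, hcmin, hp⟩ := ih
    obtain ⟨d, hd, hmin⟩ := exists_least {x | l u x ≤ i + 1} ⟨u, by simp [hself]⟩
    simp only [Set.mem_ofPred_eq] at hd hmin
    have hpos : (0 : ℝ) ≤ 2 ^ i := by positivity
    by_cases hdc : d = c
    · subst hdc
      refine ⟨d, p, hd, hmin, hp.trans ?_⟩
      rw [pow_succ]; linarith
    · have hdlt : d < c := lt_of_le_of_ne (hmin c (by omega)) hdc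
      have hl : l d c ≤ i + 1 := by
        have := hultra d u c
        rw [hsymm d u] at this
        exact this.trans (max_le hd (by omega))
      -- Since `c` is least in the ball of radius `i`, smaller vertices are at level at least `i +
      -- 1`. So the ball of radius `i + 1` is the first to reach below `c`, and its least vertex `d`
      -- is the parent of `c`: one edge climbs one level, and the costs add up geometrically.
      have hlow : ∀ x, x < c → i + 1 ≤ l x c := by
        intro x hx
        by_contra! hlt
        have h1 := hultra u c x
        rw [hsymm c x] at h1
        exact absurd (hcmin x (h1.trans (max_le hc (by omega)))) (not_le.2 hx)
      have hpar : IsParent l d c := by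
        refine ⟨hdlt, fun x hx => hl.trans (hlow x hx), fun x hx => hmin x ?_⟩
        have h1 := hultra u c x
        rw [hsymm c x] at h1
        exact h1.trans (max_le (by omega) (hx.trans hl))
      have hadj : (ultraTree l).Adj c d := Or.inr hpar
      refine ⟨d, p.append hadj.toWalk, hd, hmin, ?_⟩
      have h1 := pathWeight_append_le (ultraWeight_nonneg hsymm) p hadj.toWalk
      have h2 : pathWeight (ultraWeight l hsymm) hadj.toWalk ≤ 2 ^ (i + 1) := by
        rw [pathWeight_toWalk]
        simpa [ultraWeight, hsymm c d] using pow_le_pow_right₀ (one_le_two (α := ℝ)) hl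
      rw [pow_succ] at h2 ⊢
      linarith

theorem exists_walk_ultraTree (hsymm : ∀ a b, l a b = l b a)
    (hultra : ∀ a b c, l a c ≤ max (l a b) (l b c)) (hself : ∀ a, l a a = 0) (u v : X) :
    ∃ p : (ultraTree l).Walk u v, pathWeight (ultraWeight l hsymm) p ≤ 4 * 2 ^ l u v := by
  obtain ⟨c, p, hc, hcmin, hp⟩ := exists_walk_to_least hsymm hultra hself u (l u v)
  obtain ⟨d, q, hd, hdmin, hq⟩ := exists_walk_to_least hsymm hultra hself v (l u v)
  -- The balls of radius `l u v` around `u` and `v` coincide, so both climbs end at the same vertex.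
  have hcd : c = d := by
    refine le_antisymm (hcmin d ?_) (hdmin c ?_)
    · exact (hultra u v d).trans (max_le le_rfl hd)
    · have := hultra v u c
      rw [hsymm v u] at this
      exact this.trans (max_le le_rfl hc)
  subst hcd
  refine ⟨p.append q.reverse, ?_⟩
  have := pathWeight_append_le (ultraWeight_nonneg hsymm) p q.reverse
  rw [pathWeight_reverse] at this
  linarith

/-- Every edge is determined by its child, and the least vertex is nobody's child. A connected graph
with at most `|X| - 1` edges is a tree. -/
theorem ultraTree_isTree [Nonempty X] (hsymm : ∀ a b, l a b = l b a)
    (hultra : ∀ a b c, l a c ≤ max (l a b) (l b c)) (hself : ∀ a, l a a = 0) :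
    (ultraTree l).IsTree := by
  classical
  have hconn : (ultraTree l).Connected :=
    ⟨fun u v => ⟨(exists_walk_ultraTree hsymm hultra hself u v).choose⟩⟩
  rw [SimpleGraph.isTree_iff_connected_and_card]
  refine ⟨hconn, le_antisymm ?_ hconn.card_vert_le_card_edgeSet_add_one⟩
  obtain ⟨r, -, hr⟩ := exists_least (Set.univ : Set X) Set.univ_nonempty
  have hsub : (ultraTree l).edgeSet ⊆
      (fun a => s(Classical.epsilon fun q => IsParent l q a, a)) '' {a | a ≠ r} := by
    have key : ∀ q a, IsParent l q a → s(q, a) ∈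
        (fun a => s(Classical.epsilon fun q => IsParent l q a, a)) '' {a | a ≠ r} := by
      intro q a h
      refine ⟨a, ?_, ?_⟩
      · rintro rfl
        exact absurd (hr q (Set.mem_univ q)) (not_le.2 h.1)
      · have := (Classical.epsilon_spec (p := fun q => IsParent l q a) ⟨q, h⟩).unique h
        simp only [this]
    intro e
    induction e with
    | _ a b =>
      rintro (h | h)
      · exact key a b h
      · rw [Sym2.eq_swap]
        exact key b a h
  have h1 : (ultraTree l).edgeSet.ncard ≤ ({a | a ≠ r} : Set X).ncard :=
    (Set.ncard_le_ncard hsub (Set.toFinite _)).trans (Set.ncard_image_le (Set.toFinite _))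
  have h2 : ({a | a ≠ r} : Set X).ncard + 1 = Nat.card X := by
    have := Set.ncard_add_ncard_compl ({r} : Set X)
    rw [Set.ncard_singleton] at this
    rw [← this, add_comm]
    rfl
  rw [Nat.card_coe_set_eq]
  omega

end UltrametricTree

/-- Every ultrametric with values `2 ^ l` on a nonempty set of vertices is within a factor four of
a well-separated tree metric on this set. -/
theorem exists_wellSeparatedTreeMetric {V : Type*} [Finite V] {S : Set V} (hS : S.Nonempty)
    {l : V → V → ℕ} (hsymm : ∀ a b, l a b = l b a)
    (hultra : ∀ a b c, l a c ≤ max (l a b) (l b c)) (hself : ∀ a, l a a = 0) :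
    ∃ d : PartialMetric V, d.carrier = S ∧ d.IsWellSeparatedTreeMetric ∧
      ∀ u v : d.carrier, u ≠ v →
        (2 : ℝ) ^ l u v ≤ d.metric.dist u v ∧ d.metric.dist u v ≤ 4 * 2 ^ l u v := by
  classical
  let _ : LinearOrder V := LinearOrder.lift' (Finite.equivFin V) (Finite.equivFin V).injective
  have : Nonempty S := hS.to_subtype
  let L : S → S → ℕ := fun a b => l a b
  have hsymmL : ∀ a b, L a b = L b a := fun a b => hsymm a b
  have hultraL : ∀ a b c, L a c ≤ max (L a b) (L b c) := fun a b c => hultra a b c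
  have hselfL : ∀ a, L a a = 0 := fun a => hself a
  have htree := ultraTree_isTree hsymmL hultraL hselfL
  set w := ultraWeight L hsymmL with hwdef
  have hw : ∀ e, 0 ≤ w e := ultraWeight_nonneg hsymmL
  have hlow : ∀ u v : S, u ≠ v → (2 : ℝ) ^ L u v ≤ mixedDist (ultraTree L) w 1 0 u v := by
    intro u v huv
    have : Nonempty ((ultraTree L).Walk u v) := htree.1.preconnected u v
    exact le_ciInf fun p => by simpa using two_pow_le_pathWeight hsymmL hultraL huv p
  let met : MetricSpace S :=
    { dist := mixedDist (ultraTree L) w 1 0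
      dist_self := mixedDist_self hw zero_le_one le_rfl
      dist_comm := mixedDist_comm htree.1.preconnected hw zero_le_one le_rfl
      dist_triangle := mixedDist_triangle htree.1.preconnected hw zero_le_one le_rfl
      eq_of_dist_eq_zero := by
        intro u v h
        by_contra huv
        have h1 := hlow u v huv
        have h2 : (0 : ℝ) < 2 ^ L u v := by positivity
        have h3 : mixedDist (ultraTree L) w 1 0 u v = 0 := h
        linarith }
  obtain ⟨r, -, hr⟩ := exists_least (Set.univ : Set S) Set.univ_nonempty
  refine ⟨⟨S, met⟩, rfl, ⟨ultraTree L, w, r, htree,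
    ultraTree_isWellSeparated hsymmL hultraL fun x => hr x (Set.mem_univ x),
    fun u v => (shortestPathDist_eq_mixedDist u v).symm⟩, fun u v huv => ⟨hlow u v huv, ?_⟩⟩
  obtain ⟨p, hp⟩ := exists_walk_ultraTree hsymmL hultraL hselfL u v
  have := mixedDist_le hw zero_le_one le_rfl p
  rw [one_mul, zero_mul, add_zero] at this
  exact this.trans hp

/-! ### Counting ranks and random orders -/

section Counting

theorem card_le_of_mem_Ico {s : Finset ℕ} {a b : ℝ} (hab : a ≤ b)
    (hs : ∀ j ∈ s, a ≤ j ∧ (j : ℝ) < b) : (s.card : ℝ) ≤ b - a + 1 := by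
  have hsub : s.map Nat.castEmbedding ⊆ Finset.Ico ⌈a⌉ ⌈b⌉ := by
    intro x hx
    obtain ⟨j, hj, rfl⟩ := Finset.mem_map.1 hx
    obtain ⟨h1, h2⟩ := hs j hj
    exact Finset.mem_Ico.2 ⟨Int.ceil_le.2 (by simpa using h1), Int.lt_ceil.2 (by simpa using h2)⟩
  have hcard := Finset.card_le_card hsub
  rw [Finset.card_map, Int.card_Ico] at hcard
  have h1 : ((⌈b⌉ - ⌈a⌉).toNat : ℤ) = ⌈b⌉ - ⌈a⌉ :=
    Int.toNat_of_nonneg (sub_nonneg.2 (Int.ceil_mono hab))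
  have h2 : ((s.card : ℤ) : ℝ) ≤ ((⌈b⌉ - ⌈a⌉ : ℤ) : ℝ) := by
    exact_mod_cast (by omega : (s.card : ℤ) ≤ ⌈b⌉ - ⌈a⌉)
  push_cast at h2
  linarith [Int.ceil_lt_add_one b, Int.le_ceil a]

variable {V : Type*}

/-- Insert elements by increasing `f`: the newest has full rank, and ties can only raise the other
ranks. -/
theorem sum_inv_rank_le_harmonic (f : V → ℝ) (s : Finset V) :
    ∑ y ∈ s, ((s.filter fun z => f z ≤ f y).card : ℝ)⁻¹ ≤ (harmonic s.card : ℝ) := by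
  classical
  induction s using Finset.induction_on_max_value f with
  | empty => simp
  | insert a s ha hmax ih =>
    rw [Finset.sum_insert ha, Finset.card_insert_of_notMem ha, harmonic_succ]
    have h1 : (insert a s).filter (fun z => f z ≤ f a) = insert a s := by
      rw [Finset.filter_eq_self]
      intro z hz
      rcases Finset.mem_insert.1 hz with rfl | hz
      · exact le_rfl
      · exact hmax z hz
    have h2 : ∑ y ∈ s, (((insert a s).filter fun z => f z ≤ f y).card : ℝ)⁻¹ ≤
        ∑ y ∈ s, ((s.filter fun z => f z ≤ f y).card : ℝ)⁻¹ := by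
      refine Finset.sum_le_sum fun y hy => ?_
      have hpos : 0 < (s.filter fun z => f z ≤ f y).card :=
        Finset.card_pos.2 ⟨y, by simp [hy]⟩
      refine inv_anti₀ (by exact_mod_cast hpos) ?_
      exact_mod_cast Finset.card_le_card
        (Finset.filter_subset_filter _ (Finset.subset_insert a s))
    rw [h1, Finset.card_insert_of_notMem ha]
    push_cast
    linarith

variable [Fintype V] {n : ℕ} [DecidableEq V]

/-- In a uniformly random order, a fixed element of `S` comes first with probability at most
`1 / |S|`. -/
theorem card_first_mul_card_le (S : Finset V) {y : V} (hy : y ∈ S) :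
    (Finset.univ.filter fun σ : V ≃ Fin n => ∀ z ∈ S, σ y ≤ σ z).card * S.card ≤
      Fintype.card (V ≃ Fin n) := by
  let A : V → Finset (V ≃ Fin n) := fun s => Finset.univ.filter fun σ => ∀ z ∈ S, σ s ≤ σ z
  have hdisj : (S : Set V).PairwiseDisjoint A := by
    intro s hs t ht hst
    refine Finset.disjoint_left.2 fun σ h1 h2 => hst ?_
    simp only [A, Finset.mem_filter, Finset.mem_univ, true_and] at h1 h2
    exact σ.injective (le_antisymm (h1 t ht) (h2 s hs))
  -- Precomposing with the transposition of `s` and `y` turns orders with `y` first into orders with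
  -- `s` first.
  have hle : ∀ s ∈ S, (A y).card ≤ (A s).card := by
    intro s hs
    refine Finset.card_le_card_of_injOn (fun σ => (Equiv.swap s y).trans σ) ?_ ?_
    · intro σ hσ
      simp only [A, Finset.coe_filter, Finset.mem_univ, true_and, Set.mem_ofPred_eq,
        Equiv.trans_apply, Equiv.swap_apply_left] at hσ ⊢
      intro z hz
      refine hσ _ ?_
      rw [Equiv.swap_apply_def]
      split_ifs <;> assumption
    · intro σ _ τ _ h
      ext x
      have := congrArg (fun e : V ≃ Fin n => e (Equiv.swap s y x)) h
      simpa using congrArg Fin.val this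
  calc (A y).card * S.card = ∑ _s ∈ S, (A y).card := by rw [Finset.sum_const, smul_eq_mul, mul_comm]
    _ ≤ ∑ s ∈ S, (A s).card := Finset.sum_le_sum hle
    _ = (S.biUnion A).card := (Finset.card_biUnion hdisj).symm
    _ ≤ Fintype.card (V ≃ Fin n) := Finset.card_le_univ _

end Counting

/-! ### Ball carving with random order and radius -/

section BallCarving

variable {V : Type*} [Fintype V] {n N : ℕ} [Nonempty V]

/-- The centre to which ball carving assigns `z`: the first vertex, in the order `σ`, among those at
distance at most `r` from `z`. -/
noncomputable def carvingCenter (m : V → V → ℝ) (σ : V ≃ Fin n) (r : ℝ) (z : V) : V :=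
  Classical.epsilon fun y => m z y ≤ r ∧ ∀ x, m z x ≤ r → σ y ≤ σ x

theorem carvingCenter_spec {m : V → V → ℝ} (σ : V ≃ Fin n) {r : ℝ} {z : V} (hz : m z z ≤ r) :
    m z (carvingCenter m σ r z) ≤ r ∧ ∀ x, m z x ≤ r → σ (carvingCenter m σ r z) ≤ σ x := by
  classical
  refine Classical.epsilon_spec (p := fun y => m z y ≤ r ∧ ∀ x, m z x ≤ r → σ y ≤ σ x) ?_
  obtain ⟨y, hy, hmin⟩ := Finset.exists_min_image (Finset.univ.filter fun y => m z y ≤ r) σ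
    ⟨z, by simpa using hz⟩
  exact ⟨y, by simpa using hy, fun x hx => hmin x (by simpa using hx)⟩

theorem dist_le_of_carvingCenter_eq {m : V → V → ℝ} (hsymm : ∀ a b, m a b = m b a)
    (htri : ∀ a b c, m a c ≤ m a b + m b c) (hself : ∀ a, m a a = 0) (σ : V ≃ Fin n) {r : ℝ}
    (hr : 0 ≤ r) {u v : V} (h : carvingCenter m σ r u = carvingCenter m σ r v) :
    m u v ≤ 2 * r := by
  have hu := (carvingCenter_spec (m := m) σ (z := u) (r := r) (by rw [hself]; exact hr)).1
  have hv := (carvingCenter_spec (m := m) σ (z := v) (r := r) (by rw [hself]; exact hr)).1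
  rw [h] at hu
  rw [hsymm] at hv
  linarith [htri u (carvingCenter m σ r v) v]

/-- If ball carving cuts the ball of radius `ρ` around `x`, then some vertex `y` whose distance from
`x` is within `ρ` of the radius precedes all vertices that are at most as far from `x`. -/
theorem exists_cutter {m : V → V → ℝ} (hsymm : ∀ a b, m a b = m b a)
    (htri : ∀ a b c, m a c ≤ m a b + m b c) (hself : ∀ a, m a a = 0) (σ : V ≃ Fin n) {r ρ : ℝ}
    (hr : 0 ≤ r) (hρ : 0 ≤ ρ) {x z : V} (hxz : m x z ≤ ρ)
    (hcut : carvingCenter m σ r z ≠ carvingCenter m σ r x) :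
    ∃ y, (∀ y', m x y' ≤ m x y → σ y ≤ σ y') ∧ m x y - ρ ≤ r ∧ r < m x y + ρ := by
  classical
  -- The ball of radius `r + ρ` contains every vertex that can claim a point of the `ρ`-ball, and
  -- `y` comes first in it. If `m x y + ρ ≤ r`, then `y` can claim the whole `ρ`-ball and wins it,
  -- so nothing is cut.
  obtain ⟨y, hy, hmin⟩ := Finset.exists_min_image
    (Finset.univ.filter fun y => m x y ≤ r + ρ) σ ⟨x, by simp [hself]; linarith⟩
  simp only [Finset.mem_filter, Finset.mem_univ, true_and] at hy hmin
  refine ⟨y, fun y' hy' => hmin y' (hy'.trans hy), by linarith, ?_⟩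
  by_contra! hlt
  have key : ∀ t, m x t ≤ ρ → carvingCenter m σ r t = y := by
    intro t ht
    obtain ⟨h1, h2⟩ := carvingCenter_spec (m := m) σ (z := t) (r := r) (by rw [hself]; exact hr)
    have h3 : m t y ≤ r := by
      have := htri t x y
      rw [hsymm t x] at this
      linarith
    have h4 : m x (carvingCenter m σ r t) ≤ r + ρ := by
      linarith [htri x t (carvingCenter m σ r t)]
    exact σ.injective (le_antisymm (h2 y h3) (hmin _ h4))
  exact hcut ((key z hxz).trans (key x (by rw [hself]; exact hρ)).symm)

/-- The radius in `[0, 1/2)` with index `k` on the grid of mesh `1 / (2 N)`. -/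
noncomputable def gridRadius (k : Fin N) : ℝ := (k : ℝ) / (2 * N)

theorem gridRadius_nonneg (k : Fin N) : 0 ≤ gridRadius k := by
  unfold gridRadius; positivity

theorem two_mul_gridRadius_lt_one (k : Fin N) : 2 * gridRadius k < 1 := by
  have hN : (0 : ℝ) < N := by exact_mod_cast k.pos
  have hk : (k : ℝ) < N := by exact_mod_cast k.isLt
  unfold gridRadius
  rw [show 2 * ((k : ℝ) / (2 * N)) = k / N by field_simp, div_lt_one hN]
  exact hk

/-- A window of length `2 ρ` on a grid of mesh `1 / (2 N)`; the `+ 1` is rounding. -/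
theorem card_gridRadius_le (hN : 0 < N) (a : ℝ) {ρ : ℝ} (hρ : 0 ≤ ρ) :
    ((Finset.univ.filter fun k : Fin N => a - ρ ≤ gridRadius k ∧ gridRadius k < a + ρ).card : ℝ) ≤
      4 * ρ * N + 1 := by
  have hN' : (0 : ℝ) < N := by exact_mod_cast hN
  have hcard := card_le_of_mem_Ico
    (s := (Finset.univ.filter fun k : Fin N =>
      a - ρ ≤ gridRadius k ∧ gridRadius k < a + ρ).map Fin.valEmbedding)
    (a := (a - ρ) * (2 * N)) (b := (a + ρ) * (2 * N)) (by gcongr; linarith) (by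
      intro j hj
      obtain ⟨k, hk, rfl⟩ := Finset.mem_map.1 hj
      simp only [Finset.mem_filter, Finset.mem_univ, true_and] at hk
      unfold gridRadius at hk
      rw [le_div_iff₀ (by positivity), div_lt_iff₀ (by positivity)] at hk
      exact hk)
  rw [Finset.card_map] at hcard
  linarith

open Classical in
/-- Ball carving with a uniformly random order and a uniformly random radius on the grid cuts a ball
of radius `ρ` with probability `O(ρ log n)`. -/
theorem card_cut_le (hcard : Fintype.card V = n) (hN : 0 < N) {m : V → V → ℝ}
    (hsymm : ∀ a b, m a b = m b a) (htri : ∀ a b c, m a c ≤ m a b + m b c)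
    (hself : ∀ a, m a a = 0) {ρ : ℝ} (hρ : (N : ℝ)⁻¹ ≤ ρ) (x : V) :
    ((Finset.univ.filter fun ω : (V ≃ Fin n) × Fin N => ∃ z, m x z ≤ ρ ∧
      carvingCenter m ω.1 (gridRadius ω.2) z ≠ carvingCenter m ω.1 (gridRadius ω.2) x).card : ℝ) ≤
      5 * ρ * (1 + Real.log n) * Fintype.card ((V ≃ Fin n) × Fin N) := by
  have hN' : (0 : ℝ) < N := by exact_mod_cast hN
  have hρ0 : 0 ≤ ρ := le_trans (by positivity) hρ
  let S : V → Finset V := fun y => Finset.univ.filter fun z => m x z ≤ m x y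
  let A : V → Finset (V ≃ Fin n) := fun y => Finset.univ.filter fun σ => ∀ z ∈ S y, σ y ≤ σ z
  let W : V → Finset (Fin N) := fun y => Finset.univ.filter fun k =>
    m x y - ρ ≤ gridRadius k ∧ gridRadius k < m x y + ρ
  -- Cutters give product events: `A y` restricts only the order, `W y` only the radius, so their
  -- probabilities multiply.
  have hsub : (Finset.univ.filter fun ω : (V ≃ Fin n) × Fin N => ∃ z, m x z ≤ ρ ∧
      carvingCenter m ω.1 (gridRadius ω.2) z ≠ carvingCenter m ω.1 (gridRadius ω.2) x) ⊆
      Finset.univ.biUnion fun y => A y ×ˢ W y := by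
    intro ω hω
    simp only [Finset.mem_filter, Finset.mem_univ, true_and] at hω
    obtain ⟨z, hz, hne⟩ := hω
    obtain ⟨y, h1, h2⟩ :=
      exists_cutter hsymm htri hself ω.1 (gridRadius_nonneg ω.2) hρ0 hz hne
    simp only [Finset.mem_biUnion, Finset.mem_univ, true_and, Finset.mem_product, A, W, S,
      Finset.mem_filter]
    exact ⟨y, h1, h2⟩
  have hA : ∀ y, ((A y).card : ℝ) ≤ Fintype.card (V ≃ Fin n) * ((S y).card : ℝ)⁻¹ := by
    intro y
    have hy : y ∈ S y := by simp [S]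
    have hpos : (0 : ℝ) < (S y).card := by exact_mod_cast Finset.card_pos.2 ⟨y, hy⟩
    rw [← div_eq_mul_inv, le_div_iff₀ hpos]
    exact_mod_cast card_first_mul_card_le (S y) hy
  have hW : ∀ y, ((W y).card : ℝ) ≤ 5 * ρ * N := by
    intro y
    have h1 := card_gridRadius_le hN (m x y) hρ0
    -- As `ρ` is at least `1 / N`, the rounding term is absorbed: `4 ρ N + 1 ≤ 5 ρ N`.
    have h2 : 1 ≤ ρ * N := by
      have := mul_le_mul_of_nonneg_right hρ hN'.le
      rwa [inv_mul_cancel₀ hN'.ne'] at this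
    exact h1.trans (by linarith)
  have hharm : ∑ y, ((S y).card : ℝ)⁻¹ ≤ 1 + Real.log n := by
    have h1 := sum_inv_rank_le_harmonic (m x) Finset.univ
    rw [Finset.card_univ, hcard] at h1
    exact h1.trans (harmonic_le_one_add_log n)
  calc _ ≤ ((Finset.univ.biUnion fun y => A y ×ˢ W y).card : ℝ) := by
        exact_mod_cast Finset.card_le_card hsub
    _ ≤ ∑ y, ((A y).card : ℝ) * (W y).card := by
        have := Finset.card_biUnion_le (s := Finset.univ) (t := fun y => A y ×ˢ W y)
        simp only [Finset.card_product] at this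
        exact_mod_cast this
    _ ≤ ∑ y, Fintype.card (V ≃ Fin n) * ((S y).card : ℝ)⁻¹ * (5 * ρ * N) :=
        Finset.sum_le_sum fun y _ => mul_le_mul (hA y) (hW y) (by positivity) (by positivity)
    _ = 5 * ρ * (∑ y, ((S y).card : ℝ)⁻¹) * (Fintype.card (V ≃ Fin n) * N) := by
        rw [← Finset.sum_mul, ← Finset.mul_sum]; ring
    _ ≤ _ := by
        rw [Fintype.card_prod, Fintype.card_fin]
        push_cast
        gcongr

end BallCarving

/-! ### The ultrametric of the last separating scale -/

section SeparationLevel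

variable {V : Type*}

open Classical in
/-- The least `i` such that none of the partitions with indices in `[i, K)` separates `u` and `v`;
the partitions are given by the labels `f j u`. -/
noncomputable def sepLevel (K : ℕ) (f : ℕ → V → V) (u v : V) : ℕ :=
  ((Finset.range K).filter fun j => f j u ≠ f j v).sup (· + 1)

variable {K : ℕ} {f : ℕ → V → V}

theorem sepLevel_self (u : V) : sepLevel K f u u = 0 := by
  simp [sepLevel]

theorem sepLevel_comm (u v : V) : sepLevel K f u v = sepLevel K f v u := by
  unfold sepLevel
  congr 1
  ext j
  simp only [Finset.mem_filter, ne_comm]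

theorem succ_le_sepLevel {u v : V} {j : ℕ} (hj : j < K) (h : f j u ≠ f j v) :
    j + 1 ≤ sepLevel K f u v := by
  classical
  exact Finset.le_sup (f := (· + 1)) (by simpa using ⟨hj, h⟩)

theorem sepLevel_le (u v : V) : sepLevel K f u v ≤ K := by
  classical
  exact Finset.sup_le fun j hj => Finset.mem_range.1 (Finset.mem_filter.1 hj).1

/-- A partition separating `u` from `x` must separate `v` from one of them. -/
theorem sepLevel_le_max (u v x : V) :
    sepLevel K f u x ≤ max (sepLevel K f u v) (sepLevel K f v x) := by
  classical
  refine Finset.sup_le fun j hj => ?_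
  obtain ⟨hj, hne⟩ := Finset.mem_filter.1 hj
  rw [Finset.mem_range] at hj
  by_cases huv : f j u = f j v
  · exact le_max_of_le_right (succ_le_sepLevel hj (huv ▸ hne))
  · exact le_max_of_le_left (succ_le_sepLevel hj huv)

theorem exists_eq_of_sepLevel_pos {u v : V} (h : 0 < sepLevel K f u v) :
    ∃ j < K, sepLevel K f u v = j + 1 ∧ f j u ≠ f j v := by
  classical
  have hne : ((Finset.range K).filter fun j => f j u ≠ f j v).Nonempty := by
    by_contra hempty
    rw [Finset.not_nonempty_iff_eq_empty] at hempty
    have : sepLevel K f u v = 0 := by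
      unfold sepLevel
      rw [hempty, Finset.sup_empty]
      rfl
    omega
  obtain ⟨j, hj, hj'⟩ := Finset.exists_mem_eq_sup _ hne (· + 1)
  obtain ⟨hjK, hsep⟩ := Finset.mem_filter.1 hj
  refine ⟨j, Finset.mem_range.1 hjK, ?_, hsep⟩
  rw [← hj']
  unfold sepLevel
  congr!

end SeparationLevel

/-! ### Approximation for a fixed outcome of the carving -/

section Deterministic

variable {V : Type*} [Finite V]

open Classical in
/-- A family of partitions that separate no vertex of `S` from the vertices close to it yields
a well-separated tree metric on a superset of `S` that approximates the hop-constrained distances. -/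
theorem exists_approximating_treeMetric [Nonempty V] {w : Sym2 V → ℕ} {K : ℕ} (hK : 0 < K)
    (hw1 : ∀ e ∈ (⊤ : SimpleGraph V).edgeSet, 1 ≤ w e)
    (hwK : ∀ e ∈ (⊤ : SimpleGraph V).edgeSet, w e ≤ 2 ^ K) {h β : ℝ} (hh : 1 ≤ h) (hβ : 1 ≤ β)
    {f : ℕ → V → V}
    (hdiam : ∀ j < K, ∀ u v, f j u = f j v →
      mixedDist ⊤ (fun e => (w e : ℝ)) (2 ^ j)⁻¹ (β * h)⁻¹ u v < 1)
    {S : Set V}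
    (hpad : ∀ x ∈ S, ∀ j < K, ∀ z,
      mixedDist ⊤ (fun e => (w e : ℝ)) (2 ^ j)⁻¹ (β * h)⁻¹ x z ≤ 2 / β → f j z = f j x) :
    ∃ d : PartialMetric V, S ⊆ d.carrier ∧ d.IsWellSeparatedTreeMetric ∧
      d.Approximates ⊤ (fun e => (w e : ℝ)) h (8 * β) β ∧
      ∀ u v, d.distOrZero u v ≤ ENNReal.ofReal (∑ j ∈ (Finset.range K).filter
        (fun j => (2 : ℝ) ^ j < β * hopDist ⊤ (fun e => (w e : ℝ)) h u v),
          if f j u ≠ f j v then 8 * 2 ^ j else 0) := by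
  set W : Sym2 V → ℝ := fun e => (w e : ℝ) with hWdef
  have hW : ∀ e, 0 ≤ W e := fun e => Nat.cast_nonneg _
  have hβ0 : 0 < β := by linarith
  have hβh : 1 ≤ β * h := one_le_mul_of_one_le_of_one_le hβ hh
  have hconn : (⊤ : SimpleGraph V).Preconnected := SimpleGraph.preconnected_top
  -- A tree needs a vertex, so an empty `S` is replaced by a singleton; distinct pairs still lie in
  -- `S`.
  obtain ⟨S', hS', hSS', hpair⟩ : ∃ S' : Set V, S'.Nonempty ∧ S ⊆ S' ∧
      ∀ u ∈ S', ∀ v ∈ S', u ≠ v → u ∈ S := by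
    by_cases hS : S.Nonempty
    · exact ⟨S, hS, subset_rfl, fun u hu _ _ _ => hu⟩
    · obtain ⟨x⟩ := ‹Nonempty V›
      refine ⟨{x}, Set.singleton_nonempty x, ?_, ?_⟩
      · rw [Set.not_nonempty_iff_eq_empty.1 hS]; exact Set.empty_subset _
      · rintro u rfl v rfl huv; exact absurd rfl huv
  obtain ⟨d, hcar, htree, hdist⟩ := exists_wellSeparatedTreeMetric hS'
    (l := sepLevel K f) sepLevel_comm sepLevel_le_max sepLevel_self
  have hwalk : ∀ j < K, ∀ u v, f j u = f j v →
      ∃ p : (⊤ : SimpleGraph V).Walk u v, pathWeight W p < 2 ^ j ∧ (p.length : ℝ) ≤ β * h := by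
    intro j hj u v huv
    obtain ⟨p, hp⟩ := exists_walk_of_mixedDist_lt hconn (hdiam j hj u v huv)
    have h1 : 0 ≤ (2 ^ j)⁻¹ * pathWeight W p := mul_nonneg (by positivity) (pathWeight_nonneg hW p)
    have h2 : 0 ≤ (β * h)⁻¹ * (p.length : ℝ) := by positivity
    have h3 : (2 ^ j)⁻¹ * pathWeight W p < 1 := by linarith
    have h4 : (β * h)⁻¹ * (p.length : ℝ) ≤ 1 := by linarith
    rw [inv_mul_lt_iff₀ (by positivity), mul_one] at h3
    rw [inv_mul_le_iff₀ (by positivity), mul_one] at h4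
    exact ⟨p, h3, h4⟩
  -- A pair unseparated at scale `0` is joined by a walk of weight below `1`, less than any single
  -- edge.
  have hpos : ∀ u v : V, u ≠ v → 0 < sepLevel K f u v := by
    intro u v huv
    rw [Nat.pos_iff_ne_zero]
    intro h0
    have heq : f 0 u = f 0 v := by
      by_contra hne
      have := succ_le_sepLevel hK hne
      omega
    obtain ⟨p, hp, -⟩ := hwalk 0 hK u v heq
    cases p with
    | nil => exact huv rfl
    | @cons _ b _ hadj q =>
      have h1 := le_pathWeight_of_mem hW (SimpleGraph.Walk.cons hadj q) (e := s(u, b)) (by simp)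
      have h2 : (1 : ℝ) ≤ W s(u, b) := Nat.one_le_cast.2 (hw1 s(u, b) hadj)
      rw [pow_zero] at hp
      linarith
  have hsep : ∀ u v : d.carrier, u ≠ v → ∃ j < K, f j u ≠ f j v ∧
      d.metric.dist u v ≤ 8 * 2 ^ j ∧ (2 : ℝ) ^ j < β * hopDist ⊤ W h u v := by
    intro u v huv
    have huv' : (u : V) ≠ v := fun h => huv (Subtype.ext h)
    obtain ⟨j, hj, hlev, hne⟩ := exists_eq_of_sepLevel_pos (hpos u v huv')
    refine ⟨j, hj, hne, ?_, ?_⟩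
    · have := (hdist u v huv).2
      rw [hlev, pow_succ] at this
      linarith
    · have huS : (u : V) ∈ S := hpair u (hcar ▸ u.2) v (hcar ▸ v.2) huv'
      -- If `β d ≤ 2 ^ j`, then `m_j ≤ 1 / β + 1 / β`, and the padding of `u` forbids the
      -- separation.
      by_contra! hle
      refine hne (hpad u huS j hj v ?_).symm
      have h1 := mixedDist_top_le_hopDist hW (a := (2 ^ j)⁻¹) (b := (β * h)⁻¹) (by positivity)
        (by positivity) hh (u : V) v
      have h2 : (2 ^ j)⁻¹ * hopDist ⊤ W h (u : V) v ≤ 1 / β := by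
        rw [inv_mul_le_iff₀ (by positivity), mul_one_div, le_div_iff₀ hβ0]
        linarith
      have h3 : (β * h)⁻¹ * h = 1 / β := by
        have : h ≠ 0 := by linarith
        field_simp
      rw [h3] at h1
      calc _ ≤ _ := h1
        _ ≤ 1 / β + 1 / β := by gcongr
        _ = 2 / β := by ring
  have hself : ∀ u : d.carrier, d.metric.dist u u = 0 := d.metric.dist_self
  refine ⟨d, hcar ▸ hSS', htree, fun u v => ?_, fun u v => ?_⟩
  · by_cases huv : u = v
    · subst huv
      rw [hself, hopDist_self hW (by linarith), hopDist_self hW (by linarith)]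
      simp
    · have huv' : (u : V) ≠ v := fun h => huv (Subtype.ext h)
      refine ⟨le_trans ?_ (hdist u v huv).1, ?_⟩
      -- Below the top, the partition indexed by the level itself does not separate the pair and
      -- supplies the walk; at level `K` the direct edge is light enough.
      · by_cases hlt : sepLevel K f u v < K
        · have heq : f (sepLevel K f u v) u = f (sepLevel K f u v) v := by
            by_contra hne
            have := succ_le_sepLevel hlt hne
            omega
          obtain ⟨p, hp, hlen⟩ := hwalk _ hlt u v heq
          exact (hopDist_le hW p hlen).trans hp.le
        · rw [le_antisymm (sepLevel_le (u : V) v) (not_lt.1 hlt)]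
          refine (hopDist_top_le hW hβh huv').trans ?_
          have : (w s((u : V), (v : V)) : ℝ) ≤ ((2 ^ K : ℕ) : ℝ) := Nat.cast_le.2 (hwK _ huv')
          simpa using this
      · obtain ⟨j, -, -, h1, h2⟩ := hsep u v huv
        linarith
  · unfold PartialMetric.distOrZero
    split_ifs with hmem
    · refine ENNReal.ofReal_le_ofReal ?_
      by_cases huv : u = v
      · subst huv
        rw [hself]
        exact Finset.sum_nonneg fun j _ => by positivity
      · obtain ⟨j, hj, hne, h1, h2⟩ :=
          hsep ⟨u, hmem.1⟩ ⟨v, hmem.2⟩ fun h => huv (congrArg Subtype.val h)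
        refine h1.trans ?_
        have := Finset.single_le_sum (f := fun j => if f j u ≠ f j v then (8 : ℝ) * 2 ^ j else 0)
          (s := (Finset.range K).filter fun j => (2 : ℝ) ^ j < β * hopDist ⊤ W h u v)
          (fun j _ => by positivity) (a := j) (by simpa using ⟨hj, h2⟩)
        rwa [if_pos hne] at this
    · exact zero_le

end Deterministic

/-! ### Push-forwards of a finite uniform distribution -/

section Uniform

variable {V Ω : Type*} [Fintype Ω] [Nonempty Ω]

theorem inducedDist_map_uniform (F : Ω → PartialMetric V) (u v : V) :
    inducedDist ((PMF.uniformOfFintype Ω).map F) u v =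
      ∑ ω, (Fintype.card Ω : ENNReal)⁻¹ * (F ω).distOrZero u v := by
  classical
  unfold inducedDist
  simp only [PMF.map_apply, PMF.uniformOfFintype_apply, tsum_fintype, Finset.sum_mul, ite_mul,
    zero_mul]
  rw [Summable.tsum_finsetSum fun _ _ => ENNReal.summable]
  refine Finset.sum_congr rfl fun ω _ => ?_
  rw [tsum_eq_single (F ω) fun d hd => if_neg hd, if_pos rfl]

theorem inducedDist_map_uniform_le {F : Ω → PartialMetric V} {u v : V} {g : Ω → ℝ} {x : ℝ}
    (hg : ∀ ω, 0 ≤ g ω) (hF : ∀ ω, (F ω).distOrZero u v ≤ ENNReal.ofReal (g ω))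
    (hx : ∑ ω, g ω ≤ x * Fintype.card Ω) :
    inducedDist ((PMF.uniformOfFintype Ω).map F) u v ≤ ENNReal.ofReal x := by
  have hpos : (0 : ℝ) < Fintype.card Ω := by exact_mod_cast Fintype.card_pos
  rw [inducedDist_map_uniform, ← Finset.mul_sum, mul_comm, ← div_eq_mul_inv]
  refine ENNReal.div_le_of_le_mul ?_
  calc ∑ ω, (F ω).distOrZero u v ≤ ∑ ω, ENNReal.ofReal (g ω) := Finset.sum_le_sum fun ω _ => hF ω
    _ = ENNReal.ofReal (∑ ω, g ω) := (ENNReal.ofReal_sum_of_nonneg fun ω _ => hg ω).symm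
    _ ≤ ENNReal.ofReal (x * Fintype.card Ω) := ENNReal.ofReal_le_ofReal hx
    _ = _ := by rw [ENNReal.ofReal_mul' hpos.le, ENNReal.ofReal_natCast]

open Classical in
theorem le_toOuterMeasure_map_uniform {F : Ω → PartialMetric V} {v : V} {bad : Finset Ω} {ε : ℝ}
    (hbad : ∀ ω ∉ bad, v ∈ (F ω).carrier) (hcard : (bad.card : ℝ) ≤ ε * Fintype.card Ω) :
    ENNReal.ofReal (1 - ε) ≤
      ((PMF.uniformOfFintype Ω).map F).toOuterMeasure {d | v ∈ d.carrier} := by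
  have hpos : (0 : ℝ) < Fintype.card Ω := by exact_mod_cast Fintype.card_pos
  rw [PMF.toOuterMeasure_map_apply, PMF.toOuterMeasure_uniformOfFintype_apply,
    ENNReal.le_div_iff_mul_le (Or.inl (by simp)) (Or.inl (by simp)),
    ← ENNReal.ofReal_natCast (Fintype.card Ω), ← ENNReal.ofReal_mul' hpos.le,
    ← ENNReal.ofReal_natCast]
  refine ENNReal.ofReal_le_ofReal ?_
  have h1 : badᶜ.card ≤ Fintype.card (F ⁻¹' {d | v ∈ d.carrier}) := by
    rw [← Set.toFinset_card]
    refine Finset.card_le_card fun ω hω => ?_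
    simpa using hbad ω (by simpa using hω)
  have h2 := Finset.card_add_card_compl bad
  have h3 : (Fintype.card Ω : ℝ) ≤ bad.card + Fintype.card (F ⁻¹' {d | v ∈ d.carrier}) := by
    exact_mod_cast (by omega : Fintype.card Ω ≤ _)
  linarith

end Uniform

/-! ### Summing the expected distance over scales -/

section Estimates

theorem sum_two_pow_le {s : Finset ℕ} {d : ℝ} (hd : 0 ≤ d) (hs : ∀ j ∈ s, (2 : ℝ) ^ j ≤ d) :
    ∑ j ∈ s, (2 : ℝ) ^ j ≤ 2 * d := by
  rcases s.eq_empty_or_nonempty with rfl | hne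
  · simpa using hd
  · have hsub : s ⊆ Finset.range (s.max' hne + 1) := fun j hj =>
      Finset.mem_range.2 (Nat.lt_succ_of_le (s.le_max' j hj))
    have h1 : ∑ j ∈ s, (2 : ℝ) ^ j ≤ ∑ j ∈ Finset.range (s.max' hne + 1), (2 : ℝ) ^ j :=
      Finset.sum_le_sum_of_subset_of_nonneg hsub fun _ _ _ => by positivity
    have h2 := hs _ (s.max'_mem hne)
    rw [geom_sum_eq (by norm_num), pow_succ] at h1
    linarith

/-- The contribution of all scales to the expected distance. -/
theorem sum_scales_le {s : Finset ℕ} {d β Λ : ℝ} (hd : 0 ≤ d) (hβ : 1 ≤ β) (hΛ : 0 ≤ Λ)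
    {q : ℕ → ℝ} (hs : ∀ j ∈ s, (2 : ℝ) ^ j < β * d) (hq1 : ∀ j ∈ s, q j ≤ 1)
    (hq : ∀ j ∈ s, q j ≤ 5 * (d / 2 ^ j + 1 / β) * Λ) :
    ∑ j ∈ s, 8 * 2 ^ j * q j ≤ (16 + 80 * Λ * (Real.logb 2 β + 1)) * d := by
  have hβ0 : 0 < β := by linarith
  rw [← Finset.sum_filter_add_sum_filter_not s fun j => (2 : ℝ) ^ j ≤ d]
  have h1 : ∑ j ∈ s.filter (fun j => (2 : ℝ) ^ j ≤ d), 8 * 2 ^ j * q j ≤ 16 * d := by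
    calc _ ≤ ∑ j ∈ s.filter (fun j => (2 : ℝ) ^ j ≤ d), 8 * (2 : ℝ) ^ j := by
          refine Finset.sum_le_sum fun j hj => ?_
          exact mul_le_of_le_one_right (by positivity) (hq1 j (Finset.mem_filter.1 hj).1)
      _ = 8 * ∑ j ∈ s.filter (fun j => (2 : ℝ) ^ j ≤ d), (2 : ℝ) ^ j := by rw [Finset.mul_sum]
      _ ≤ 8 * (2 * d) := by
          gcongr
          exact sum_two_pow_le hd fun j hj => (Finset.mem_filter.1 hj).2
      _ = 16 * d := by ring
  have h2 : ∀ j ∈ s.filter (fun j => ¬ (2 : ℝ) ^ j ≤ d), 8 * 2 ^ j * q j ≤ 80 * Λ * d := by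
    intro j hj
    have hjs := (Finset.mem_filter.1 hj).1
    have hpos : (0 : ℝ) < 2 ^ j := by positivity
    -- Since `2 ^ j < β d`, the additive error `1 / β` is dominated by the main term.
    have h3 : 1 / β ≤ d / 2 ^ j := by
      rw [div_le_div_iff₀ hβ0 hpos]
      linarith [hs j hjs]
    calc 8 * 2 ^ j * q j ≤ 8 * 2 ^ j * (5 * (d / 2 ^ j + d / 2 ^ j) * Λ) := by
          gcongr
          exact (hq j hjs).trans (by gcongr)
      _ = 80 * Λ * d := by field_simp; ring
  have h3 := Finset.sum_le_card_nsmul _ _ _ h2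
  rw [nsmul_eq_mul] at h3
  have h4 : ((s.filter (fun j => ¬ (2 : ℝ) ^ j ≤ d)).card : ℝ) * d ≤
      (Real.logb 2 β + 1) * d := by
    rcases hd.eq_or_lt with rfl | hd
    · simp
    · refine mul_le_mul_of_nonneg_right ?_ hd.le
      have := card_le_of_mem_Ico (s := s.filter (fun j => ¬ (2 : ℝ) ^ j ≤ d))
        (a := Real.logb 2 d) (b := Real.logb 2 β + Real.logb 2 d)
        (by linarith [Real.logb_nonneg one_lt_two hβ]) (by
          intro j hj
          obtain ⟨hjs, hjd⟩ := Finset.mem_filter.1 hj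
          rw [← Real.logb_mul hβ0.ne' hd.ne']
          constructor
          · rw [Real.logb_le_iff_le_rpow one_lt_two hd, Real.rpow_natCast]
            exact (not_le.1 hjd).le
          · rw [Real.lt_logb_iff_rpow_lt one_lt_two (by positivity), Real.rpow_natCast]
            exact hs j hjs)
      linarith
  have h5 := mul_le_mul_of_nonneg_left h4 (by positivity : 0 ≤ 80 * Λ)
  linarith

end Estimates

/-! ### Numerical bounds on the parameters -/

section Parameters

theorem pow_le_two_pow_levels (c : ℕ) {n : ℕ} :
    n ^ c ≤ 2 ^ (c * (Nat.log 2 n + 1) + 1) := by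
  calc n ^ c ≤ (2 ^ (Nat.log 2 n + 1)) ^ c :=
        Nat.pow_le_pow_left (Nat.lt_pow_succ_log_self one_lt_two n).le c
    _ = 2 ^ (c * (Nat.log 2 n + 1)) := by rw [← pow_mul, mul_comm]
    _ ≤ _ := Nat.pow_le_pow_right two_pos (Nat.le_succ _)

theorem levels_le (c : ℕ) {n : ℕ} (hn : 2 ≤ n) :
    ((c * (Nat.log 2 n + 1) + 1 : ℕ) : ℝ) ≤ 3 * (c + 1) * Real.log n := by
  have hn' : (2 : ℝ) ≤ n := by exact_mod_cast hn
  have hlog : Real.log 2 ≤ Real.log n := Real.log_le_log two_pos hn'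
  have h2 := Real.log_two_gt_d9
  have h1 : (Nat.log 2 n : ℝ) * Real.log 2 ≤ Real.log n := by
    rw [← Real.log_pow]
    refine Real.log_le_log (by positivity) ?_
    exact_mod_cast Nat.pow_log_le_self 2 (by omega : n ≠ 0)
  have h3 : (Nat.log 2 n : ℝ) + 1 ≤ 3 * Real.log n := by
    have h0 : (0 : ℝ) ≤ Nat.log 2 n := Nat.cast_nonneg _
    nlinarith
  push_cast
  have h4 := mul_le_mul_of_nonneg_left h3 (Nat.cast_nonneg c : (0 : ℝ) ≤ c)
  linarith

/-- The bound on the expected stretch, where `x` stands for `log n`. -/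
theorem expectedStretch_le {x ε β A : ℝ} (hx : Real.log 2 ≤ x) (hε : 0 < ε) (hε' : ε < 1 / 3)
    (hA : 1 ≤ A) (hβ1 : 1 ≤ β) (hβ : β ≤ A * (x ^ 2 / ε)) :
    16 + 80 * (1 + x) * (Real.logb 2 β + 1) ≤
      (40 + 240 * (3 * A + 5)) * (x * Real.log (x / ε)) := by
  have h2 := Real.log_two_gt_d9
  have hx0 : 0 < x := by linarith
  -- From `ε < 1/3` and `log 2 > 2/3`; this keeps `log (x / ε)` away from zero, so constants can be
  -- absorbed into it.
  have hxε : 2 ≤ x / ε := by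
    rw [le_div_iff₀ hε]; linarith
  set y := Real.log (x / ε) with hy
  have hy2 : Real.log 2 ≤ y := Real.log_le_log two_pos hxε
  have hβ' : β ≤ A * (x / ε) ^ 2 := by
    refine hβ.trans (mul_le_mul_of_nonneg_left ?_ (by linarith))
    rw [div_pow]
    refine div_le_div_of_nonneg_left (by positivity) (by positivity) ?_
    nlinarith
  have hlogβ : Real.log β ≤ A + 2 * y := by
    have h := Real.log_le_log (by linarith) hβ'
    rw [Real.log_mul (by linarith) (by positivity), Real.log_pow, ← hy] at h
    have := Real.log_le_sub_one_of_pos (by linarith : 0 < A)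
    push_cast at h
    linarith
  have hlogb : Real.logb 2 β ≤ 3 / 2 * (A + 2 * y) := by
    rw [Real.logb, div_le_iff₀ (by linarith)]
    have h0 : 0 ≤ A + 2 * y := by linarith
    nlinarith
  have hlogb' : Real.logb 2 β + 1 ≤ (3 * A + 5) * y := by
    nlinarith
  have h1 : 80 * (1 + x) ≤ 240 * x := by linarith
  have h3 : (16 : ℝ) ≤ 40 * (x * y) := by nlinarith
  have h4 : 80 * (1 + x) * (Real.logb 2 β + 1) ≤ 240 * x * ((3 * A + 5) * y) :=
    mul_le_mul h1 hlogb' (by linarith [Real.logb_nonneg one_lt_two hβ1]) (by linarith)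
  linarith

end Parameters

end HopConstrained

/-! ### Choice of parameters and assembly -/

open HopConstrained
theorem mainTheorem1 (c : ℕ) :
    ∃ C : ℝ, 0 < C ∧
      ∀ (V : Type*) [Fintype V] (n : ℕ), Fintype.card V = n → 2 ≤ n →
      ∀ w : Sym2 V → ℕ, (∀ e ∈ (⊤ : SimpleGraph V).edgeSet, 1 ≤ w e ∧ w e ≤ n ^ c) →
      ∀ h : ℝ, 1 ≤ h →
      ∀ ε : ℝ, 0 < ε → ε < 1 / 3 →
      ∃ (D : PMF (PartialMetric V)) (αE αWC β : ℝ),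
        (∀ d ∈ D.support, d.IsWellSeparatedTreeMetric) ∧
        ExclusionProbabilityLE D ε ∧
        HasExpectedStretch D ⊤ (fun e => (w e : ℝ)) h αE ∧
        HasWorstCaseStretch D ⊤ (fun e => (w e : ℝ)) h αWC β ∧
        αE ≤ C * (Real.log n * Real.log (Real.log n / ε)) ∧
        αWC ≤ C * (Real.log n ^ 2 / ε) ∧
        β ≤ C * (Real.log n ^ 2 / ε) := by
  classical
  -- `10 · 3 (c + 1) · 3`: the factor in `β`, the bound on `K`, and `1 + log n ≤ 3 log n`.
  set A : ℝ := 90 * (c + 1) with hA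
  have hc0 : (0 : ℝ) ≤ c := Nat.cast_nonneg c
  have hA1 : 1 ≤ A := by linarith
  refine ⟨40 + 240 * (3 * A + 5), by linarith, ?_⟩
  intro V _ n hcard hn w hw h hh ε hε hε'
  have hn' : (2 : ℝ) ≤ n := by exact_mod_cast hn
  have hx : Real.log 2 ≤ Real.log n := Real.log_le_log two_pos hn'
  have hlog2 := Real.log_two_gt_d9
  have hne : Nonempty V := Fintype.card_pos_iff.1 (by omega)
  set K : ℕ := c * (Nat.log 2 n + 1) + 1 with hKdef
  have hK1 : (1 : ℝ) ≤ K := by exact_mod_cast (by omega : 1 ≤ K)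
  set Λ : ℝ := 1 + Real.log n with hΛ
  have hΛ1 : 1 ≤ Λ := by linarith
  -- Solves `K · 5 (2 / β) Λ = ε`, the union bound over scales for cutting a `2 / β`-ball.
  set β : ℝ := 10 * K * Λ / ε with hβdef
  have hKΛ : 1 ≤ K * Λ := one_le_mul_of_one_le_of_one_le hK1 hΛ1
  have hβ1 : 1 ≤ β := by
    rw [hβdef, le_div_iff₀ hε]
    linarith
  have hβ0 : 0 < β := by linarith
  have hβA : β ≤ A * (Real.log n ^ 2 / ε) := by
    have h1 : (K : ℝ) ≤ 3 * (c + 1) * Real.log n := levels_le c hn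
    have h2 : Λ ≤ 3 * Real.log n := by linarith
    rw [hβdef, hA, ← mul_div_assoc]
    refine div_le_div_of_nonneg_right ?_ hε.le
    have := mul_le_mul h1 h2 (by linarith) (by nlinarith)
    linarith
  -- The grid of radii must resolve balls of radius `1 / β`.
  obtain ⟨N, hN⟩ := exists_nat_ge β
  have hN0 : 0 < N := by exact_mod_cast hβ0.trans_le hN
  have hNinv : (N : ℝ)⁻¹ ≤ 1 / β := by
    rw [← one_div]
    exact one_div_le_one_div_of_le hβ0 hN
  let W : Sym2 V → ℝ := fun e => (w e : ℝ)
  have hW : ∀ e, 0 ≤ W e := fun e => Nat.cast_nonneg _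
  have hβh : 0 < β * h := by positivity
  have hconn : (⊤ : SimpleGraph V).Preconnected := SimpleGraph.preconnected_top
  let m : ℕ → V → V → ℝ := fun j => mixedDist ⊤ W (2 ^ j)⁻¹ (β * h)⁻¹
  have ha : ∀ j : ℕ, (0 : ℝ) ≤ (2 ^ j)⁻¹ := fun j => by positivity
  have hb : 0 ≤ (β * h)⁻¹ := by positivity
  have hsymm : ∀ j a b, m j a b = m j b a := fun j => mixedDist_comm hconn hW (ha j) hb
  have htri : ∀ j a b c, m j a c ≤ m j a b + m j b c :=
    fun j => mixedDist_triangle hconn hW (ha j) hb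
  have hself : ∀ j a, m j a a = 0 := fun j => mixedDist_self hW (ha j) hb
  let Ω := (V ≃ Fin n) × Fin N
  have : Nonempty Ω := ⟨(Fintype.equivFinOfCardEq hcard, ⟨0, hN0⟩)⟩
  let f : Ω → ℕ → V → V := fun ω j => carvingCenter (m j) ω.1 (gridRadius ω.2)
  let S : Ω → Set V := fun ω => {x | ∀ j < K, ∀ z, m j x z ≤ 2 / β → f ω j z = f ω j x}
  have hcut : ∀ j x (ρ : ℝ), 1 / β ≤ ρ →
      ((Finset.univ.filter fun ω : Ω => ∃ z, m j x z ≤ ρ ∧ f ω j z ≠ f ω j x).card : ℝ) ≤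
        5 * ρ * Λ * Fintype.card Ω := fun j x ρ hρ =>
    card_cut_le hcard hN0 (hsymm j) (htri j) (hself j) (hNinv.trans hρ) x
  have hex : ∀ ω : Ω, _ := fun ω => exists_approximating_treeMetric (w := w) (K := K) (f := f ω)
    (S := S ω) (h := h) (β := β) (by omega) (fun e he => (hw e he).1)
    (fun e he => (hw e he).2.trans (pow_le_two_pow_levels c)) hh hβ1
    (fun j _ u v huv => (dist_le_of_carvingCenter_eq (hsymm j) (htri j) (hself j) ω.1
      (gridRadius_nonneg ω.2) huv).trans_lt (two_mul_gridRadius_lt_one ω.2))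
    (fun x hx j hj z hz => hx j hj z hz)
  choose F hFS hFtree hFapprox hFdist using hex
  have hsupp : ∀ d ∈ ((PMF.uniformOfFintype Ω).map F).support, ∃ ω, F ω = d := by
    intro d hd
    obtain ⟨ω, -, h⟩ := (PMF.mem_support_map_iff _ _ _).1 hd
    exact ⟨ω, h⟩
  refine ⟨(PMF.uniformOfFintype Ω).map F, 16 + 80 * Λ * (Real.logb 2 β + 1), 8 * β, β,
    ?_, ?_, ?_, ⟨by linarith, hβ1, ?_⟩, expectedStretch_le hx hε hε' hA1 hβ1 hβA, ?_, ?_⟩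
  · intro d hd
    obtain ⟨ω, rfl⟩ := hsupp d hd
    exact hFtree ω
  · intro v
    refine le_toOuterMeasure_map_uniform (bad := (Finset.range K).biUnion fun j =>
      Finset.univ.filter fun ω : Ω => ∃ z, m j v z ≤ 2 / β ∧ f ω j z ≠ f ω j v) ?_ ?_
    · intro ω hω
      refine hFS ω fun j hj z hz => ?_
      by_contra hne
      exact hω (Finset.mem_biUnion.2 ⟨j, Finset.mem_range.2 hj, by simpa using ⟨z, hz, hne⟩⟩)
    · have h1 : ∀ j ∈ Finset.range K, ((Finset.univ.filter fun ω : Ω =>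
          ∃ z, m j v z ≤ 2 / β ∧ f ω j z ≠ f ω j v).card : ℝ) ≤
            5 * (2 / β) * Λ * Fintype.card Ω := fun j _ =>
        hcut j v (2 / β) (by gcongr; norm_num)
      refine (Nat.cast_le.2 Finset.card_biUnion_le).trans ?_
      rw [Nat.cast_sum]
      refine (Finset.sum_le_card_nsmul _ _ _ h1).trans (le_of_eq ?_)
      rw [Finset.card_range, nsmul_eq_mul, hβdef]
      have : Λ ≠ 0 := by linarith
      have : (K : ℝ) ≠ 0 := by linarith
      field_simp
      norm_num
  · intro u v
    refine inducedDist_map_uniform_le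
      (fun ω => Finset.sum_nonneg fun j _ => by positivity) (fun ω => hFdist ω u v) ?_
    have hΩ : (0 : ℝ) < Fintype.card Ω := by exact_mod_cast Fintype.card_pos
    set d := hopDist ⊤ W h u v with hd
    have hd0 : 0 ≤ d := hopDist_nonneg hW h u v
    let q : ℕ → ℝ := fun j =>
      ((Finset.univ.filter fun ω : Ω => f ω j u ≠ f ω j v).card : ℝ) / Fintype.card Ω
    have hq1 : ∀ j, q j ≤ 1 := fun j => by
      rw [div_le_one hΩ]
      exact_mod_cast Finset.card_le_univ _
    -- Separating `u` from `v` cuts the ball around `v` whose radius is the upper bound for `m_j(v,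
    -- u)`.
    have hq : ∀ j, q j ≤ 5 * (d / 2 ^ j + 1 / β) * Λ := fun j => by
      rw [div_le_iff₀ hΩ]
      refine le_trans ?_ (hcut j v (d / 2 ^ j + 1 / β) (by
        have : 0 ≤ d / 2 ^ j := by positivity
        linarith))
      refine Nat.cast_le.2 (Finset.card_le_card fun ω hω => ?_)
      simp only [Finset.mem_filter, Finset.mem_univ, true_and] at hω ⊢
      refine ⟨u, ?_, hω⟩
      rw [hsymm]
      refine (mixedDist_top_le_hopDist hW (by positivity) hb hh u v).trans (le_of_eq ?_)
      have : h ≠ 0 := by linarith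
      rw [← hd]
      field_simp
    have hsum := sum_scales_le (s := (Finset.range K).filter fun j => (2 : ℝ) ^ j < β * d)
      hd0 hβ1 (by linarith : 0 ≤ Λ) (fun j hj => (Finset.mem_filter.1 hj).2)
      (fun j _ => hq1 j) (fun j _ => hq j)
    refine le_trans (le_of_eq ?_) (mul_le_mul_of_nonneg_right hsum hΩ.le)
    rw [Finset.sum_comm, Finset.sum_mul]
    refine Finset.sum_congr rfl fun j _ => ?_
    rw [← Finset.sum_filter, Finset.sum_const, nsmul_eq_mul]
    simp only [q]
    field_simp
  · intro d hd
    obtain ⟨ω, rfl⟩ := hsupp d hd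
    exact hFapprox ω
  · have : 0 ≤ Real.log n ^ 2 / ε := by positivity
    nlinarith
  · have : 0 ≤ Real.log n ^ 2 / ε := by positivity
    nlinarith
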